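/- Let $d\ge 2$ and $k\ge 1$ be integers. A lattice polytope in $\mathbb{R}^d$ is a polytope all of whose vertices lie in $\mathbb{Z}^d$. Let $P\subset\mathbb{R}^d$ be a $d$-dimensional polytope with vertex set $\mathcal{V}$. A point $x\in\mathbb{R}^d\setminus P$ can be inserted in $P$ if the vertex set of $\mathrm{conv}(P\cup\{x\})$ is exactly $\mathcal{V}\cup\{x\}$; the insertion move then transforms $P$ into $\mathrm{conv}(P\cup\{x\})$. A vertex $v\in\mathcal{V}$ can be deleted from $P$ if $\mathrm{conv}(\mathcal{V}\setminus\{v\})$ is $d$-dimensional; the deletion move then transforms $P$ into $\mathrm{conv}(\mathcal{V}\setminus\{v\})$. Let $\Lambda(d,k)$ be the graph whose vertices are the $d$-dimensional lattice polytopes contained in the hypercube $[0,k]^d$ and whose edges connect two polytopes when one is obtained from the other by an insertion move or a deletion move. **Theorem.** The subgraph induced in $\Lambda(d,k)$ by the simplices and the polytopes with $d+2$ vertices is connected. -/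

import Mathlib

namespace ElementaryMoves

/-- A polytope in `ℝ^d`: the convex hull of a finite set of points. -/
def IsPolytope {d : ℕ} (P : Set (Fin d → ℝ)) : Prop :=
  ∃ s : Set (Fin d → ℝ), s.Finite ∧ P = convexHull ℝ s

/-- A subset of `ℝ^d` is `d`-dimensional when its affine hull is the whole space. -/
def IsFullDimensional {d : ℕ} (P : Set (Fin d → ℝ)) : Prop :=
  affineSpan ℝ P = ⊤

/-- The vertex set of a polytope: the set of its extreme points. -/
def vertexSet {d : ℕ} (P : Set (Fin d → ℝ)) : Set (Fin d → ℝ) :=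
  P.extremePoints ℝ

/-- The `d`-dimensional polytopes contained in `ℝ^d`. -/
def Polytope (d : ℕ) : Type :=
  {P : Set (Fin d → ℝ) // IsPolytope P ∧ IsFullDimensional P}

/-- The point `x` can be inserted in `P`: it lies outside of `P` and the vertices of the convex
hull of `P ∪ {x}` are exactly the vertices of `P` together with `x`. -/
def CanInsert {d : ℕ} (P : Set (Fin d → ℝ)) (x : Fin d → ℝ) : Prop :=
  x ∉ P ∧ vertexSet (convexHull ℝ (P ∪ {x})) = vertexSet P ∪ {x}

/-- The vertex `v` can be deleted from `P`: the convex hull of the other vertices of `P` is still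
`d`-dimensional. -/
def CanDelete {d : ℕ} (P : Set (Fin d → ℝ)) (v : Fin d → ℝ) : Prop :=
  v ∈ vertexSet P ∧ IsFullDimensional (convexHull ℝ (vertexSet P \ {v}))

/-- `Q` is obtained from `P` by an insertion move. -/
def IsInsertionMove {d : ℕ} (P Q : Set (Fin d → ℝ)) : Prop :=
  ∃ x, CanInsert P x ∧ Q = convexHull ℝ (P ∪ {x})

/-- `Q` is obtained from `P` by a deletion move. -/
def IsDeletionMove {d : ℕ} (P Q : Set (Fin d → ℝ)) : Prop :=
  ∃ v, CanDelete P v ∧ Q = convexHull ℝ (vertexSet P \ {v})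

/-- The graph `Γ(d)` on the `d`-dimensional polytopes of `ℝ^d`: two distinct polytopes are adjacent
when one is obtained from the other by an insertion move or a deletion move. -/
def moveGraph (d : ℕ) : SimpleGraph (Polytope d) :=
  SimpleGraph.fromRel fun P Q => IsInsertionMove P.1 Q.1 ∨ IsDeletionMove P.1 Q.1

/-- A lattice polytope: all the vertices belong to `ℤ^d`. -/
def IsLattice {d : ℕ} (P : Set (Fin d → ℝ)) : Prop :=
  ∀ v ∈ vertexSet P, ∀ i, ∃ z : ℤ, v i = z

/-- The hypercube `[0,k]^d`. -/
def cube (d k : ℕ) : Set (Fin d → ℝ) :=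
  {x | ∀ i, 0 ≤ x i ∧ x i ≤ k}

/-- The `d`-dimensional lattice polytopes contained in the hypercube `[0,k]^d`. -/
def latticePolytopesInCube (d k : ℕ) : Set (Polytope d) :=
  {P | IsLattice P.1 ∧ P.1 ⊆ cube d k}

/-- The graph `Λ(d,k)`: the subgraph induced in `Γ(d)` by the lattice polytopes contained in
`[0,k]^d`. -/
def latticeMoveGraph (d k : ℕ) : SimpleGraph (latticePolytopesInCube d k) :=
  (moveGraph d).induce (latticePolytopesInCube d k)

/-- A simplex: a polytope whose vertices are affinely independent. -/
def IsSimplex {d : ℕ} (P : Set (Fin d → ℝ)) : Prop :=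
  AffineIndependent ℝ (Subtype.val : vertexSet P → Fin d → ℝ)

end ElementaryMoves

namespace ElementaryMoves

open Function Set

variable {d k : ℕ}

/-! ### Finite sets in convex position -/

/-! Every node is linked to a simplex by deleting a superfluous vertex, so it suffices to link
simplices, handled as affine bases `b`. If a lattice point `x` is in convex position with a simplex,
inserting `x` and then deleting a vertex `b s` with `b.coord s x ≠ 0` exchanges the two. By
`inConvexPosition_insert`, two positive and one negative barycentric coordinates of `x` suffice.

Exchanges push simplices to the corners of the hypercube: `improvable_of_not_onWall` lowers
`interiorCount`, the number of vertex coordinates different from `0` and `k`, by sliding a vertex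
along a coordinate axis. The delicate cases are an edge parallel to the axis and a slide ending
inside the facet opposite the vertex.

Any set of corners is in convex position, so `linked_of_corners` joins two corner simplices by basis
exchange, as in a matroid. -/

/-- A set of points, each of which is outside of the convex hull of the others. -/
def InConvexPosition (V : Set (Fin d → ℝ)) : Prop :=
  ∀ x ∈ V, x ∉ convexHull ℝ (V \ {x})

theorem InConvexPosition.mono {V W : Set (Fin d → ℝ)} (hW : InConvexPosition W) (h : V ⊆ W) :
    InConvexPosition V :=
  fun x hx hmem => hW x (h hx) (convexHull_mono (sdiff_subset_sdiff_left h) hmem)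

/-- A point at which an affine function is positive, while it is nonpositive on `W`, is not in the
convex hull of `W`. -/
theorem notMem_convexHull_of_pos {W : Set (Fin d → ℝ)} {x : Fin d → ℝ}
    (f : (Fin d → ℝ) →ᵃ[ℝ] ℝ) (hx : 0 < f x) (hW : ∀ y ∈ W, f y ≤ 0) : x ∉ convexHull ℝ W := by
  intro h
  have hconv : Convex ℝ (f ⁻¹' Iic 0) := (convex_Iic (0 : ℝ)).affine_preimage f
  have : x ∈ f ⁻¹' Iic 0 := convexHull_min (fun y hy => hW y hy) hconv h
  exact absurd hx (not_lt.2 this)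

theorem finite_vertexSet {P : Set (Fin d → ℝ)} (hP : IsPolytope P) : (vertexSet P).Finite := by
  obtain ⟨s, hs, rfl⟩ := hP
  exact hs.subset extremePoints_convexHull_subset

/-- This is Krein–Milman; the closure is superfluous because there are finitely many extreme points.
-/
theorem convexHull_vertexSet {P : Set (Fin d → ℝ)} (hP : IsPolytope P) :
    convexHull ℝ (vertexSet P) = P := by
  have hfin := finite_vertexSet hP
  obtain ⟨s, hs, rfl⟩ := hP
  have h := closure_convexHull_extremePoints (hs.isCompact_convexHull ℝ) (convex_convexHull ℝ s)
  exact (hfin.isClosed_convexHull ℝ).closure_eq.symm.trans h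

theorem vertexSet_convexHull {V : Set (Fin d → ℝ)} (hV : V.Finite) (hpos : InConvexPosition V) :
    vertexSet (convexHull ℝ V) = V := by
  refine Subset.antisymm extremePoints_convexHull_subset fun x hx => ?_
  by_contra hxe
  apply hpos x hx
  have h1 : x ∈ convexHull ℝ (vertexSet (convexHull ℝ V)) := by
    rw [convexHull_vertexSet ⟨V, hV, rfl⟩]
    exact subset_convexHull ℝ V hx
  have h2 : vertexSet (convexHull ℝ V) ⊆ V \ {x} := by
    intro y hy
    refine ⟨extremePoints_convexHull_subset hy, ?_⟩
    rintro rfl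
    exact hxe hy
  exact convexHull_mono h2 h1

theorem inConvexPosition_vertexSet {P : Set (Fin d → ℝ)} (hP : IsPolytope P) :
    InConvexPosition (vertexSet P) := by
  intro x hx hmem
  have hconv : Convex ℝ P := by
    obtain ⟨s, -, rfl⟩ := hP
    exact convex_convexHull ℝ s
  have := (hconv.mem_extremePoints_iff_convex_sdiff.1 hx).2
  have hsub : vertexSet P \ {x} ⊆ P \ {x} := fun y hy => ⟨hy.1.1, hy.2⟩
  exact (convexHull_min hsub this hmem).2 rfl

/-! ### Affine bases -/

theorem ncard_range_basis (b : AffineBasis (Fin (d + 1)) ℝ (Fin d → ℝ)) :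
    (range b).ncard = d + 1 := by
  rw [← image_univ, ncard_image_of_injective _ b.ind.injective, ncard_univ]
  simp

theorem inConvexPosition_range (b : AffineBasis (Fin (d + 1)) ℝ (Fin d → ℝ)) :
    InConvexPosition (range b) := by
  rintro _ ⟨j, rfl⟩
  refine notMem_convexHull_of_pos (b.coord j) (by simp) ?_
  rintro _ ⟨⟨i, rfl⟩, hi⟩
  rw [b.coord_apply_ne]
  rintro rfl
  exact hi rfl

theorem exists_basis_of_spanning {W : Set (Fin d → ℝ)} (hcard : W.ncard = d + 1)
    (hspan : affineSpan ℝ W = ⊤) :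
    ∃ b : AffineBasis (Fin (d + 1)) ℝ (Fin d → ℝ), range b = W := by
  have hfin : W.Finite := finite_of_ncard_ne_zero (by omega)
  obtain ⟨s, hs, b, hb⟩ := AffineBasis.exists_affine_subbasis hspan
  have := (hfin.subset hs).fintype
  have hc : Fintype.card s = d + 1 := by simpa using b.card_eq_finrank_add_one
  have hsW : s = W := by
    refine eq_of_subset_of_ncard_le hs ?_ hfin
    rw [hcard, ← hc, ← Nat.card_coe_set_eq, Nat.card_eq_fintype_card]
  refine ⟨b.reindex (Fintype.equivFinOfCardEq hc), ?_⟩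
  rw [AffineBasis.coe_reindex, (Equiv.surjective _).range_comp, hb, Subtype.range_coe, hsW]

/-- The coordinate `b.coord j` vanishes on the span of the other vertices, so `x` lies off that
hyperplane. -/
theorem exists_update_basis (b : AffineBasis (Fin (d + 1)) ℝ (Fin d → ℝ)) {j : Fin (d + 1)}
    {x : Fin d → ℝ} (h : b.coord j x ≠ 0) :
    ∃ b' : AffineBasis (Fin (d + 1)) ℝ (Fin d → ℝ), ⇑b' = update b j x := by
  have hind : AffineIndependent ℝ (update b j x) := by
    refine AffineIndependent.affineIndependent_of_notMem_span (i := j) ?_ ?_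
    · convert! b.ind.comp_embedding (Embedding.subtype fun y => y ≠ j) using 1
      ext ⟨y, hy⟩ i
      simp [update_of_ne hy]
    · intro hmem
      apply h
      have hle : affineSpan ℝ (update b j x '' {y | y ≠ j}) ≤
          (affineSpan ℝ {(0 : ℝ)}).comap (b.coord j) := by
        rw [affineSpan_le]
        rintro _ ⟨y, hy, rfl⟩
        simp only [update_of_ne hy]
        simp [b.coord_apply_ne (Ne.symm hy)]
      simpa using hle hmem
  refine ⟨⟨_, hind, ?_⟩, rfl⟩
  rw [hind.affineSpan_eq_top_iff_card_eq_finrank_add_one]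
  simp

/-! ### Reachability in the induced graph -/

/-- The vertices of the induced subgraph, as sets of points. -/
def IsNode (d k : ℕ) (P : Set (Fin d → ℝ)) : Prop :=
  (IsPolytope P ∧ IsFullDimensional P) ∧ (IsLattice P ∧ P ⊆ cube d k) ∧
    (IsSimplex P ∨ (vertexSet P).ncard = d + 2)

/-- The subgraph of `Λ(d,k)` induced by the simplices and the polytopes with `d + 2` vertices. -/
abbrev lowGraph (d k : ℕ) :=
  (latticeMoveGraph d k).induce {P | IsSimplex P.1.1 ∨ (vertexSet P.1.1).ncard = d + 2}

/-- Two sets of points are vertices of the induced subgraph in the same connected component. -/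
def Linked (d k : ℕ) (P Q : Set (Fin d → ℝ)) : Prop :=
  ∃ (hP : IsNode d k P) (hQ : IsNode d k Q),
    (lowGraph d k).Reachable ⟨⟨⟨P, hP.1⟩, hP.2.1⟩, hP.2.2⟩ ⟨⟨⟨Q, hQ.1⟩, hQ.2.1⟩, hQ.2.2⟩

theorem IsNode.linked_refl {P : Set (Fin d → ℝ)} (hP : IsNode d k P) : Linked d k P P :=
  ⟨hP, hP, .refl _⟩

theorem Linked.symm {P Q : Set (Fin d → ℝ)} (h : Linked d k P Q) : Linked d k Q P := by
  obtain ⟨hP, hQ, h⟩ := h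
  exact ⟨hQ, hP, h.symm⟩

theorem Linked.trans {P Q R : Set (Fin d → ℝ)} (h : Linked d k P Q) (h' : Linked d k Q R) :
    Linked d k P R := by
  obtain ⟨hP, hQ, h⟩ := h
  obtain ⟨_, hR, h'⟩ := h'
  exact ⟨hP, hR, h.trans h'⟩

/-- The lattice points contained in the hypercube `[0,k]^d`. -/
def grid (d k : ℕ) : Set (Fin d → ℝ) :=
  {x | ∀ i, (∃ z : ℤ, x i = z) ∧ 0 ≤ x i ∧ x i ≤ k}

theorem convex_cube : Convex ℝ (cube d k) := by
  have : cube d k = Icc 0 fun _ => (k : ℝ) := by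
    ext x
    simp [cube, Pi.le_def, forall_and]
  rw [this]
  exact convex_Icc _ _

theorem isNode_convexHull {V : Set (Fin d → ℝ)} (hfin : V.Finite) (hpos : InConvexPosition V)
    (hgrid : V ⊆ grid d k) (hspan : affineSpan ℝ V = ⊤)
    (h : AffineIndependent ℝ (Subtype.val : V → Fin d → ℝ) ∨ V.ncard = d + 2) :
    IsNode d k (convexHull ℝ V) := by
  have hv := vertexSet_convexHull hfin hpos
  refine ⟨⟨⟨V, hfin, rfl⟩, ?_⟩, ⟨?_, ?_⟩, ?_⟩
  · rwa [IsFullDimensional, affineSpan_convexHull]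
  · intro v hvm i
    rw [hv] at hvm
    exact (hgrid hvm i).1
  · exact convexHull_min (fun x hx i => (hgrid hx i).2) convex_cube
  · rwa [IsSimplex, hv]

theorem isNode_range (b : AffineBasis (Fin (d + 1)) ℝ (Fin d → ℝ)) (hb : range b ⊆ grid d k) :
    IsNode d k (convexHull ℝ (range b)) :=
  isNode_convexHull (finite_range b) (inConvexPosition_range b) hb b.tot (.inl b.ind.range)

/-- Deleting a vertex from a polytope with `d + 2` vertices. -/
theorem linked_of_delete {V : Set (Fin d → ℝ)} (hpos : InConvexPosition V)
    (hgrid : V ⊆ grid d k) (hcard : V.ncard = d + 2) {v : Fin d → ℝ} (hv : v ∈ V)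
    (hspan : affineSpan ℝ (V \ {v}) = ⊤) :
    Linked d k (convexHull ℝ V) (convexHull ℝ (V \ {v})) := by
  have hfin : V.Finite := finite_of_ncard_ne_zero (by omega)
  have hvert := vertexSet_convexHull hfin hpos
  have hP : IsNode d k (convexHull ℝ V) :=
    isNode_convexHull hfin hpos hgrid
      (top_le_iff.1 (hspan.symm.le.trans (affineSpan_mono ℝ sdiff_subset))) (.inr hcard)
  obtain ⟨b, hb⟩ := exists_basis_of_spanning (W := V \ {v})
    (by rw [ncard_sdiff_singleton_of_mem hv, hcard]; rfl) hspan
  have hQ : IsNode d k (convexHull ℝ (V \ {v})) := by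
    rw [← hb]
    exact isNode_range b (hb ▸ sdiff_subset.trans hgrid)
  refine ⟨hP, hQ, SimpleGraph.Adj.reachable ?_⟩
  have hne : convexHull ℝ V ≠ convexHull ℝ (V \ {v}) := fun h =>
    hpos v hv (h ▸ subset_convexHull ℝ V hv)
  have hmove : IsDeletionMove (convexHull ℝ V) (convexHull ℝ (V \ {v})) := by
    refine ⟨v, ⟨hvert.symm ▸ hv, ?_⟩, by rw [hvert]⟩
    rw [hvert, IsFullDimensional, affineSpan_convexHull, hspan]
  exact ⟨fun h => hne (congrArg Subtype.val h), .inl (.inr hmove)⟩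

/-- Every vertex of the induced subgraph is linked to a simplex. -/
theorem IsNode.exists_linked_basis {P : Set (Fin d → ℝ)} (hP : IsNode d k P) :
    ∃ b : AffineBasis (Fin (d + 1)) ℝ (Fin d → ℝ), range b ⊆ grid d k ∧
      Linked d k P (convexHull ℝ (range b)) := by
  have hPV := convexHull_vertexSet hP.1.1
  have hfin := finite_vertexSet hP.1.1
  have hgrid : vertexSet P ⊆ grid d k := fun x hx i =>
    ⟨hP.2.1.1 x hx i, hP.2.1.2 hx.1 i⟩
  have hspan : affineSpan ℝ (vertexSet P) = ⊤ := by
    rw [← affineSpan_convexHull, hPV]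
    exact hP.1.2
  rcases hP.2.2 with h | h
  · have := hfin.fintype
    have hc : (vertexSet P).ncard = d + 1 := by
      have := (AffineIndependent.affineSpan_eq_top_iff_card_eq_finrank_add_one
        (p := (Subtype.val : vertexSet P → Fin d → ℝ)) h).1 (by rwa [Subtype.range_coe])
      rw [← Nat.card_coe_set_eq, Nat.card_eq_fintype_card, this]
      simp
    obtain ⟨b, hb⟩ := exists_basis_of_spanning hc hspan
    refine ⟨b, hb ▸ hgrid, ?_⟩
    rw [hb, hPV]
    exact hP.linked_refl
  · obtain ⟨s, hs, b, hb⟩ := AffineBasis.exists_affine_subbasis hspan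
    have := (hfin.subset hs).fintype
    have hc : s.ncard = d + 1 := by
      rw [← Nat.card_coe_set_eq, Nat.card_eq_fintype_card, b.card_eq_finrank_add_one]
      simp
    -- A basis chosen among the `d + 2` vertices misses one of them, whose deletion preserves the
    -- dimension.
    obtain ⟨v, hv, hvs⟩ := exists_mem_notMem_of_ncard_lt_ncard (hc.trans_lt (by omega) :
      s.ncard < (vertexSet P).ncard) (hfin.subset hs)
    have hsp : affineSpan ℝ (vertexSet P \ {v}) = ⊤ := by
      have hle : s ⊆ vertexSet P \ {v} := fun y hy => ⟨hs hy, fun h => hvs (h ▸ hy)⟩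
      have := b.tot
      rw [hb, Subtype.range_coe] at this
      exact top_le_iff.1 (this.symm.le.trans (affineSpan_mono ℝ hle))
    obtain ⟨c, hc⟩ := exists_basis_of_spanning (W := vertexSet P \ {v})
      (by rw [ncard_sdiff_singleton_of_mem hv, h]; rfl) hsp
    refine ⟨c, hc ▸ sdiff_subset.trans hgrid, ?_⟩
    have := linked_of_delete (inConvexPosition_vertexSet hP.1.1) hgrid h hv hsp
    rwa [hPV, ← hc] at this

/-! ### Exchanging a vertex of a simplex -/

/-- Exchange of a vertex of a simplex with a point that is in convex position with the simplex. -/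
theorem exists_exchange_of_inConvexPosition (b : AffineBasis (Fin (d + 1)) ℝ (Fin d → ℝ))
    (hb : range b ⊆ grid d k) {x : Fin d → ℝ} (hx : x ∈ grid d k) (hxb : x ∉ range b)
    (hpos : InConvexPosition (insert x (range b))) {s : Fin (d + 1)} (hs : b.coord s x ≠ 0) :
    ∃ b' : AffineBasis (Fin (d + 1)) ℝ (Fin d → ℝ), ⇑b' = update b s x ∧ range b' ⊆ grid d k ∧
      Linked d k (convexHull ℝ (range b)) (convexHull ℝ (range b')) := by
  obtain ⟨b', hb'⟩ := exists_update_basis b hs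
  have hgrid : insert x (range b) ⊆ grid d k := insert_subset hx hb
  have hcard : (insert x (range b)).ncard = d + 2 := by
    rw [ncard_insert_of_notMem hxb (finite_range b), ncard_range_basis]
  have h1 : insert x (range b) \ {x} = range b := by simp [hxb]
  have h2 : insert x (range b) \ {b s} = range b' := by
    have hsub : insert x (range b) \ {b s} ⊆ range b' := by
      rintro y ⟨rfl | ⟨j, rfl⟩, hy⟩
      · exact ⟨s, by simp [hb']⟩
      · have hjs : j ≠ s := by
          rintro rfl
          exact hy rfl
        exact ⟨j, by simp [hb', hjs]⟩
    refine eq_of_subset_of_ncard_le hsub ?_ (finite_range b')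
    rw [ncard_range_basis, ncard_sdiff_singleton_of_mem (by simp), hcard]
    omega
  -- Both simplices arise by one deletion from the same polytope with `d + 2` vertices.
  have l1 := linked_of_delete hpos hgrid hcard (mem_insert x _) (by rw [h1, b.tot])
  have l2 := linked_of_delete hpos hgrid hcard (v := b s) (by simp) (by rw [h2, b'.tot])
  rw [h1] at l1
  rw [h2] at l2
  exact ⟨b', hb', h2 ▸ sdiff_subset.trans hgrid, l1.symm.trans l2⟩

/-- A point with two positive and one negative barycentric coordinates is in convex position with
the simplex. -/
theorem inConvexPosition_insert (b : AffineBasis (Fin (d + 1)) ℝ (Fin d → ℝ)) {x : Fin d → ℝ}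
    {i j l : Fin (d + 1)} (hij : i ≠ j) (hi : 0 < b.coord i x) (hj : 0 < b.coord j x)
    (hl : b.coord l x < 0) : InConvexPosition (insert x (range b)) := by
  have hx : x ∉ range b := by
    rintro ⟨m, rfl⟩
    rw [b.coord_apply] at hl
    split_ifs at hl <;> linarith
  rintro y (rfl | ⟨m, rfl⟩)
  · refine notMem_convexHull_of_pos (-b.coord l) (by simpa using hl) ?_
    rintro z ⟨rfl | ⟨m, rfl⟩, hz⟩
    · exact absurd rfl hz
    · simp only [AffineMap.coe_neg, Pi.neg_apply, b.coord_apply]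
      split_ifs <;> simp
  · by_cases hm : b.coord m x ≤ 0
    · refine notMem_convexHull_of_pos (b.coord m) (by simp) ?_
      rintro z ⟨rfl | ⟨n, rfl⟩, hz⟩
      · exact hm
      · rw [b.coord_apply_ne]
        rintro rfl
        exact hz rfl
    · push Not at hm
      obtain ⟨n, hnm, hn⟩ : ∃ n, n ≠ m ∧ 0 < b.coord n x := by
        by_cases him : i = m
        · exact ⟨j, fun h => hij (him.trans h.symm), hj⟩
        · exact ⟨i, him, hi⟩
      -- This combination vanishes at `x`, is positive at `b m` and nonpositive at the other
      -- vertices.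
      refine notMem_convexHull_of_pos
        (b.coord n x • b.coord m - b.coord m x • b.coord n) ?_ ?_
      · simp [b.coord_apply_ne hnm, hn]
      · rintro z ⟨rfl | ⟨q, rfl⟩, hz⟩
        · simp [mul_comm]
        · have hqm : m ≠ q := by
            rintro rfl
            exact hz rfl
          have : 0 ≤ b.coord n (b q) := by
            rw [b.coord_apply]
            split_ifs <;> simp
          simp only [AffineMap.coe_sub, AffineMap.coe_smul, Pi.sub_apply, Pi.smul_apply,
            smul_eq_mul, b.coord_apply_ne hqm]
          nlinarith

/-- The vertex `s` given up need not be one of `i`, `j`, `l`: their signs provide convex position,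
while `hs` alone keeps the new simplex nondegenerate. -/
theorem exists_exchange (b : AffineBasis (Fin (d + 1)) ℝ (Fin d → ℝ))
    (hb : range b ⊆ grid d k) {x : Fin d → ℝ} (hx : x ∈ grid d k) {s i j l : Fin (d + 1)}
    (hs : b.coord s x ≠ 0) (hij : i ≠ j) (hi : 0 < b.coord i x) (hj : 0 < b.coord j x)
    (hl : b.coord l x < 0) :
    ∃ b' : AffineBasis (Fin (d + 1)) ℝ (Fin d → ℝ), ⇑b' = update b s x ∧ range b' ⊆ grid d k ∧
      Linked d k (convexHull ℝ (range b)) (convexHull ℝ (range b')) := by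
  refine exists_exchange_of_inConvexPosition b hb hx ?_ (inConvexPosition_insert b hij hi hj hl) hs
  rintro ⟨m, rfl⟩
  rw [b.coord_apply] at hl
  split_ifs at hl <;> linarith

/-! ### Sliding vertices to the walls of the hypercube -/

/-- A coordinate of a point that lies on a pair of opposite facets of the hypercube. -/
def OnWall (k : ℕ) (t : ℝ) : Prop := t = 0 ∨ t = k

theorem update_mem_grid {x : Fin d → ℝ} (hx : x ∈ grid d k) (i : Fin d) {c : ℝ}
    (hc : OnWall k c) : update x i c ∈ grid d k := by
  intro l
  by_cases h : l = i
  · subst h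
    rw [update_self]
    rcases hc with rfl | rfl
    · exact ⟨⟨0, by simp⟩, le_rfl, by positivity⟩
    · exact ⟨⟨k, by simp⟩, by positivity, le_rfl⟩
  · rw [update_of_ne h]
    exact hx l

/-- The variation of a barycentric coordinate along a vector of the canonical basis. -/
noncomputable def slope (b : AffineBasis (Fin (d + 1)) ℝ (Fin d → ℝ)) (i : Fin d)
    (j : Fin (d + 1)) : ℝ :=
  (b.coord j).linear (Pi.single i 1)

theorem coord_update (b : AffineBasis (Fin (d + 1)) ℝ (Fin d → ℝ)) (i : Fin d) (j : Fin (d + 1))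
    (x : Fin d → ℝ) (c : ℝ) :
    b.coord j (update x i c) = b.coord j x + (c - x i) * slope b i j := by
  have : update x i c = ((c - x i) • (Pi.single i 1 : Fin d → ℝ)) +ᵥ x := by
    ext l
    by_cases h : l = i
    · subst h
      simp
    · simp [h]
  rw [this, AffineMap.map_vadd, map_smul, slope, smul_eq_mul, vadd_eq_add, add_comm]

/-- Barycentric coordinates sum to one both before and after a displacement. -/
theorem sum_slope (b : AffineBasis (Fin (d + 1)) ℝ (Fin d → ℝ)) (i : Fin d) :
    ∑ j, slope b i j = 0 := by
  have h1 := b.sum_coord_apply_eq_one 0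
  have h2 := b.sum_coord_apply_eq_one (update 0 i 1)
  simp only [coord_update, Finset.sum_add_distrib, h1] at h2
  simpa using h2

/-- The number of coordinates of vertices that are not on a wall of the hypercube. -/
noncomputable def interiorCount (k : ℕ) (p : Fin (d + 1) → Fin d → ℝ) : ℕ :=
  {q : Fin (d + 1) × Fin d | ¬OnWall k (p q.1 q.2)}.ncard

theorem interiorCount_update_lt {p : Fin (d + 1) → Fin d → ℝ} {s : Fin (d + 1)} {x : Fin d → ℝ}
    {i : Fin d} (hi : ¬OnWall k (p s i)) (hxi : OnWall k (x i))
    (h : ∀ l, OnWall k (p s l) → OnWall k (x l)) :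
    interiorCount k (update p s x) < interiorCount k p := by
  refine ncard_lt_ncard ⟨?_, ?_⟩ (toFinite _)
  · rintro ⟨j, l⟩ hjl
    by_cases hj : j = s
    · subst hj
      simp only [mem_ofPred_eq, update_self] at hjl ⊢
      exact fun hw => hjl (h l hw)
    · simpa [hj] using hjl
  · intro hsub
    have : (s, i) ∈ {q : Fin (d + 1) × Fin d | ¬OnWall k (update p s x q.1 q.2)} := hsub hi
    simp only [mem_ofPred_eq, update_self] at this
    exact this hxi

/-- The simplex can be transformed into another one with more coordinates of vertices on the walls
of the hypercube. -/
def Improvable (k : ℕ) (b : AffineBasis (Fin (d + 1)) ℝ (Fin d → ℝ)) : Prop :=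
  ∃ b' : AffineBasis (Fin (d + 1)) ℝ (Fin d → ℝ), range b' ⊆ grid d k ∧
    Linked d k (convexHull ℝ (range b)) (convexHull ℝ (range b')) ∧
    interiorCount k b' < interiorCount k b

theorem lt_and_lt_of_not_onWall {x : Fin d → ℝ} (hx : x ∈ grid d k) {i : Fin d}
    (h : ¬OnWall k (x i)) : 0 < x i ∧ x i < k := by
  rw [OnWall, not_or] at h
  exact ⟨lt_of_le_of_ne (hx i).2.1 (Ne.symm h.1), lt_of_le_of_ne (hx i).2.2 h.2⟩

/-- Replacing a vertex by a point with two positive and one negative barycentric coordinates. -/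
theorem improvable_of_exchange (b : AffineBasis (Fin (d + 1)) ℝ (Fin d → ℝ))
    (hb : range b ⊆ grid d k) {x : Fin d → ℝ} (hx : x ∈ grid d k) {s j j' l : Fin (d + 1)}
    (hs : b.coord s x ≠ 0) (hjj : j ≠ j') (hj : 0 < b.coord j x) (hj' : 0 < b.coord j' x)
    (hl : b.coord l x < 0) {i : Fin d} (hi : ¬OnWall k (b s i)) (hxi : OnWall k (x i))
    (h : ∀ l, OnWall k (b s l) → OnWall k (x l)) : Improvable k b := by
  obtain ⟨b', hb', hgrid, hlink⟩ := exists_exchange b hb hx hs hjj hj hj' hl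
  exact ⟨b', hgrid, hlink, hb' ▸ interiorCount_update_lt hi hxi h⟩

theorem onWall_update {x : Fin d → ℝ} {i : Fin d} {c : ℝ} (hc : OnWall k c) (l : Fin d)
    (h : OnWall k (x l)) : OnWall k (update x i c l) := by
  by_cases hl : l = i
  · subst hl
    rwa [update_self]
  · rwa [update_of_ne hl]

/-- Slide `b s` in a direction that does not decrease its own coordinate, which thus stays positive.
Whatever the direction, one of `j`, `j'` gives a second positive coordinate and the other a negative
one. -/
theorem improvable_of_slopes (b : AffineBasis (Fin (d + 1)) ℝ (Fin d → ℝ))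
    (hb : range b ⊆ grid d k) {s : Fin (d + 1)} {i : Fin d} (hi : ¬OnWall k (b s i))
    {j j' : Fin (d + 1)} (hjs : j ≠ s) (hjs' : j' ≠ s) (hj : 0 < slope b i j)
    (hj' : slope b i j' < 0) : Improvable k b := by
  obtain ⟨h0, h1⟩ := lt_and_lt_of_not_onWall (hb (mem_range_self s)) hi
  obtain ⟨c, hc, hne, hcs⟩ : ∃ c, OnWall k c ∧ c - b s i ≠ 0 ∧ 0 ≤ (c - b s i) * slope b i s := by
    rcases le_total 0 (slope b i s) with h | h
    · exact ⟨k, .inr rfl, (sub_pos.2 h1).ne', mul_nonneg (sub_pos.2 h1).le h⟩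
    · exact ⟨0, .inl rfl, (sub_neg.2 h0).ne, mul_nonneg_of_nonpos_of_nonpos (sub_neg.2 h0).le h⟩
  have hs : 0 < b.coord s (update (b s) i c) := by
    rw [coord_update, b.coord_apply_eq]
    linarith
  have hcoord : ∀ m, m ≠ s → b.coord m (update (b s) i c) = (c - b s i) * slope b i m := by
    intro m hm
    rw [coord_update, b.coord_apply_ne hm, zero_add]
  have hx := update_mem_grid (hb (mem_range_self s)) i hc
  have hxi : OnWall k (update (b s) i c i) := by rwa [update_self]
  rcases hne.lt_or_gt with hn | hn
  · exact improvable_of_exchange b hb hx hs.ne' hjs'.symm hs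
      (by rw [hcoord _ hjs']; exact mul_pos_of_neg_of_neg hn hj')
      (l := j) (by rw [hcoord _ hjs]; exact mul_neg_of_neg_of_pos hn hj) hi hxi (onWall_update hc)
  · exact improvable_of_exchange b hb hx hs.ne' hjs.symm hs
      (by rw [hcoord _ hjs]; exact mul_pos hn hj)
      (l := j') (by rw [hcoord _ hjs']; exact mul_neg_of_pos_of_neg hn hj') hi hxi
      (onWall_update hc)

/-- Either the simplex can be improved by sliding a vertex along a line, or that line enters the
simplex at the vertex. -/
theorem improvable_or_exists_wall (b : AffineBasis (Fin (d + 1)) ℝ (Fin d → ℝ))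
    (hb : range b ⊆ grid d k) {s : Fin (d + 1)} {i : Fin d} (hi : ¬OnWall k (b s i)) :
    Improvable k b ∨ ∃ c, OnWall k c ∧ c ≠ b s i ∧ (∀ j ≠ s, 0 ≤ (c - b s i) * slope b i j) ∧
      (c - b s i) * slope b i s < 0 ∧ ∃ j ≠ s, 0 < (c - b s i) * slope b i j := by
  by_cases hmix : (∃ j ≠ s, 0 < slope b i j) ∧ ∃ j ≠ s, slope b i j < 0
  · obtain ⟨⟨j, hjs, hj⟩, j', hjs', hj'⟩ := hmix
    exact .inl (improvable_of_slopes b hb hi hjs hjs' hj hj')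
  right
  obtain ⟨h0, h1⟩ := lt_and_lt_of_not_onWall (hb (mem_range_self s)) hi
  obtain ⟨c, hc, hne, hnn⟩ :
      ∃ c, OnWall k c ∧ c ≠ b s i ∧ ∀ j ≠ s, 0 ≤ (c - b s i) * slope b i j := by
    rw [not_and_or] at hmix
    push Not at hmix
    rcases hmix with h | h
    · exact ⟨0, .inl rfl, h0.ne, fun j hj =>
        mul_nonneg_of_nonpos_of_nonpos (sub_neg.2 h0).le (h j hj)⟩
    · exact ⟨k, .inr rfl, h1.ne', fun j hj => mul_nonneg (sub_pos.2 h1).le (h j hj)⟩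
  have hsum : (c - b s i) * slope b i s +
      ∑ j ∈ Finset.univ.erase s, (c - b s i) * slope b i j = 0 := by
    rw [Finset.add_sum_erase _ (fun j => (c - b s i) * slope b i j) (Finset.mem_univ s),
      ← Finset.mul_sum, sum_slope, mul_zero]
  have hex : ∃ j ≠ s, 0 < (c - b s i) * slope b i j := by
    by_contra! hcon
    have hz : ∀ j ≠ s, (c - b s i) * slope b i j = 0 := fun j hj =>
      le_antisymm (hcon j hj) (hnn j hj)
    rw [Finset.sum_eq_zero fun j hj => hz j (Finset.ne_of_mem_erase hj), add_zero] at hsum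
    -- If every barycentric coordinate were unchanged, the slide would not move the point, yet `c ≠
    -- b s i`.
    have : update (b s) i c = b s := by
      refine b.ext_elem fun j => ?_
      rw [coord_update]
      by_cases hj : j = s
      · rw [hj, hsum, add_zero]
      · rw [hz j hj, add_zero]
    exact hne (by simpa using congrFun this i)
  refine ⟨c, hc, hne, hnn, ?_, hex⟩
  obtain ⟨j, hjs, hj⟩ := hex
  have := Finset.sum_pos' (s := Finset.univ.erase s) (f := fun j => (c - b s i) * slope b i j)
    (fun m hm => hnn m (Finset.ne_of_mem_erase hm)) ⟨j, by simp [hjs], hj⟩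
  linarith

/-- A point of the simplex on a facet of the hypercube only involves vertices on that facet. -/
theorem eq_of_coord_pos (b : AffineBasis (Fin (d + 1)) ℝ (Fin d → ℝ)) (hb : range b ⊆ grid d k)
    {x : Fin d → ℝ} (hx : ∀ j, 0 ≤ b.coord j x) {i : Fin d} (hi : OnWall k (x i))
    {j : Fin (d + 1)} (hj : 0 < b.coord j x) : b j i = x i := by
  have h1 := b.sum_coord_apply_eq_one x
  have h2 : ∑ m, b.coord m x * b m i = x i := by
    have := congrFun (b.linear_combination_coord_eq_self x) i
    simpa using this
  have h3 : ∑ m, b.coord m x * (b m i - x i) = 0 := by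
    simp only [mul_sub, Finset.sum_sub_distrib, ← Finset.sum_mul, h1, h2]
    ring
  -- As `x i` is an extreme value of the coordinate on the hypercube, all terms of the vanishing sum
  -- `h3` have the same sign.
  have h4 : b.coord j x * (b j i - x i) = 0 := by
    rcases hi with hi | hi
    · refine (Finset.sum_eq_zero_iff_of_nonneg fun m _ => ?_).1 h3 j (Finset.mem_univ j)
      rw [hi, sub_zero]
      exact mul_nonneg (hx m) (hb (mem_range_self m) i).2.1
    · refine (Finset.sum_eq_zero_iff_of_nonpos fun m _ => ?_).1 h3 j (Finset.mem_univ j)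
      rw [hi]
      exact mul_nonpos_of_nonneg_of_nonpos (hx m) (sub_nonpos.2 (hb (mem_range_self m) i).2.2)
  rcases mul_eq_zero.1 h4 with h | h
  · exact absurd h hj.ne'
  · exact sub_eq_zero.1 h

theorem exists_onWall_ne (hk : 0 < k) (t : ℝ) : ∃ c, OnWall k c ∧ c ≠ t := by
  by_cases h : t = 0
  · exact ⟨k, .inr rfl, by rw [h]; positivity⟩
  · exact ⟨0, .inl rfl, Ne.symm h⟩

/-- The case of an edge parallel to a vector of the canonical basis. -/
theorem improvable_of_parallel (hd : 2 ≤ d) (hk : 0 < k)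
    (b : AffineBasis (Fin (d + 1)) ℝ (Fin d → ℝ)) (hb : range b ⊆ grid d k) {s j : Fin (d + 1)}
    {i : Fin d} (hi : ¬OnWall k (b s i)) (hjs : j ≠ s) (hj : slope b i j ≠ 0)
    (hz : ∀ m, m ≠ s → m ≠ j → slope b i m = 0) : Improvable k b := by
  have hs : slope b i s = -slope b i j := by
    have h := sum_slope b i
    rw [← Finset.add_sum_erase _ _ (Finset.mem_univ s),
      Finset.sum_eq_single_of_mem j (by simp [hjs])
        (fun m hm hmj => hz m (Finset.ne_of_mem_erase hm) hmj)] at h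
    linarith
  -- A third vertex exists because `d ≥ 2`.
  obtain ⟨r, hrs, hrj⟩ : ∃ r, r ≠ s ∧ r ≠ j := by
    have : ∃ r, r ∉ ({s, j} : Finset (Fin (d + 1))) := by
      by_contra! hall
      have h1 := Finset.card_le_card fun r (_ : r ∈ Finset.univ) => hall r
      have h2 := Finset.card_le_two (a := s) (b := j)
      simp only [Finset.card_univ, Fintype.card_fin] at h1
      omega
    simpa using this
  have hline : b j = update (b s) i (b s i + (slope b i j)⁻¹) := by
    refine b.ext_elem fun m => ?_
    rw [coord_update, add_sub_cancel_left]
    by_cases hms : m = s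
    · subst hms
      rw [hs, b.coord_apply_ne hjs.symm, b.coord_apply_eq]
      field_simp
      ring
    · rw [b.coord_apply_ne hms]
      by_cases hmj : m = j
      · subst hmj
        rw [b.coord_apply_eq]
        field_simp
        ring
      · rw [hz m hms hmj, b.coord_apply_ne hmj]
        ring
  obtain ⟨c₁, hc₁, hne₁⟩ := exists_onWall_ne hk (b r i)
  obtain ⟨c₂, hc₂, hne₂⟩ := exists_onWall_ne hk (b j i)
  have hx₁ := update_mem_grid (hb (mem_range_self r)) i hc₁
  have hr : b.coord r (update (b r) i c₁) = 1 := by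
    rw [coord_update, b.coord_apply_eq, hz r hrs hrj]
    ring
  have hcs : b.coord s (update (b r) i c₁) = -((c₁ - b r i) * slope b i j) := by
    rw [coord_update, b.coord_apply_ne hrs.symm, hs]
    ring
  have hcj : b.coord j (update (b r) i c₁) = (c₁ - b r i) * slope b i j := by
    rw [coord_update, b.coord_apply_ne hrj.symm, zero_add]
  have hτ : (c₁ - b r i) * slope b i j ≠ 0 := mul_ne_zero (sub_ne_zero.2 hne₁) hj
  -- Sliding `b s` along the edge never gives two positive and one negative coordinates. Hence `s`
  -- is first replaced by a translate of `b r`, making the edge from `r` to `s` parallel to the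
  -- axis; `interiorCount` may grow temporarily.
  obtain ⟨b₁, hb₁, hgrid₁, hlink₁⟩ : ∃ b' : AffineBasis (Fin (d + 1)) ℝ (Fin d → ℝ),
      ⇑b' = update b s (update (b r) i c₁) ∧ range b' ⊆ grid d k ∧
      Linked d k (convexHull ℝ (range b)) (convexHull ℝ (range b')) := by
    rcases hτ.lt_or_gt with h | h
    · exact exists_exchange b hb hx₁ (s := s) (i := r) (j := s) (l := j)
        (by rw [hcs]; exact neg_ne_zero.2 hτ) hrs (by rw [hr]; exact one_pos)
        (by rw [hcs]; linarith) (by rw [hcj]; exact h)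
    · exact exists_exchange b hb hx₁ (s := s) (i := r) (j := j) (l := s)
        (by rw [hcs]; exact neg_ne_zero.2 hτ) hrj (by rw [hr]; exact one_pos)
        (by rw [hcj]; exact h) (by rw [hcs]; linarith)
  have hb₁s : b₁ s = update (b r) i c₁ := by simp [hb₁]
  have hb₁r : b₁ r = b r := by simp [hb₁, hrs]
  have hb₁j : b₁ j = b j := by simp [hb₁, hjs]
  have hslope : ∀ m, (c₁ - b r i) * slope b₁ i m = b₁.coord m (b₁ s) - b₁.coord m (b₁ r) := by
    intro m
    rw [hb₁s, coord_update, hb₁r]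
    ring
  have hss := hslope s
  have hsr := hslope r
  have hsj := hslope j
  rw [b₁.coord_apply_eq, b₁.coord_apply_ne hrs.symm] at hss
  rw [b₁.coord_apply_eq, b₁.coord_apply_ne hrs] at hsr
  rw [b₁.coord_apply_ne hjs, b₁.coord_apply_ne hrj.symm] at hsj
  have hτ₁ := sub_ne_zero.2 hne₁
  have hκ := sub_ne_zero.2 hne₂
  have hx₂ : update (b s) i c₂ ∈ grid d k := update_mem_grid (hb (mem_range_self s)) i hc₂
  -- Since `b s` and `b j` lie on one line parallel to the axis, the target is also a slide of `b
  -- j`. Its coordinates in `b₁` are then `1` at `j` and opposite values at `s` and `r`.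
  have hx₂j : update (b s) i c₂ = update (b₁ j) i c₂ := by rw [hb₁j, hline, update_idem]
  have es : b₁.coord s (update (b s) i c₂) = (c₂ - b j i) / (c₁ - b r i) := by
    rw [hx₂j, coord_update, b₁.coord_apply_ne hjs.symm, hb₁j, eq_div_iff hτ₁]
    linear_combination (c₂ - b j i) * hss
  have er : b₁.coord r (update (b s) i c₂) = -((c₂ - b j i) / (c₁ - b r i)) := by
    rw [hx₂j, coord_update, b₁.coord_apply_ne hrj, hb₁j, ← neg_div, eq_div_iff hτ₁]
    linear_combination (c₂ - b j i) * hsr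
  have ej : b₁.coord j (update (b s) i c₂) = 1 := by
    have : slope b₁ i j = 0 := by
      rcases mul_eq_zero.1 (hsj.trans (sub_zero 0)) with h | h
      · exact absurd h hτ₁
      · exact h
    rw [hx₂j, coord_update, b₁.coord_apply_eq, this]
    ring
  have hq : (c₂ - b j i) / (c₁ - b r i) ≠ 0 := div_ne_zero hκ hτ₁
  obtain ⟨b₂, hb₂, hgrid₂, hlink₂⟩ : ∃ b' : AffineBasis (Fin (d + 1)) ℝ (Fin d → ℝ),
      ⇑b' = update b₁ s (update (b s) i c₂) ∧ range b' ⊆ grid d k ∧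
      Linked d k (convexHull ℝ (range b₁)) (convexHull ℝ (range b')) := by
    rcases hq.lt_or_gt with h | h
    · exact exists_exchange b₁ hgrid₁ hx₂ (s := s) (i := j) (j := r) (l := s)
        (by rwa [es]) hrj.symm (by rw [ej]; exact one_pos) (by rw [er]; linarith) (by rwa [es])
    · exact exists_exchange b₁ hgrid₁ hx₂ (s := s) (i := j) (j := s) (l := r)
        (by rwa [es]) hjs (by rw [ej]; exact one_pos) (by rwa [es]) (by rw [er]; linarith)
  refine ⟨b₂, hgrid₂, hlink₁.trans hlink₂, ?_⟩
  rw [hb₂, hb₁, update_idem]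
  exact interiorCount_update_lt hi (by rwa [update_self]) (onWall_update hc₂)

theorem improvable_of_not_onWall (hd : 2 ≤ d) (hk : 0 < k)
    (b : AffineBasis (Fin (d + 1)) ℝ (Fin d → ℝ)) (hb : range b ⊆ grid d k) {s : Fin (d + 1)}
    {i : Fin d} (hi : ¬OnWall k (b s i)) : Improvable k b := by
  obtain h | ⟨c, hc, hne, hnn, hneg, j, hjs, hj⟩ := improvable_or_exists_wall b hb hi
  · exact h
  by_cases hpar : ∀ m, m ≠ s → m ≠ j → slope b i m = 0
  · exact improvable_of_parallel hd hk b hb hi hjs (right_ne_zero_of_mul hj.ne') hpar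
  push Not at hpar
  obtain ⟨j', hjs', hjj', hj'⟩ := hpar
  have hj'pos : 0 < (c - b s i) * slope b i j' :=
    lt_of_le_of_ne (hnn j' hjs') (mul_ne_zero (sub_ne_zero.2 hne) hj').symm
  set x := update (b s) i c with hxdef
  have hx : x ∈ grid d k := update_mem_grid (hb (mem_range_self s)) i hc
  have hxi : x i = c := by rw [hxdef, update_self]
  have hcoord : ∀ m, m ≠ s → b.coord m x = (c - b s i) * slope b i m := by
    intro m hm
    rw [hxdef, coord_update, b.coord_apply_ne hm, zero_add]
  rw [← hcoord j hjs] at hj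
  rw [← hcoord j' hjs'] at hj'pos
  rcases lt_or_ge (b.coord s x) 0 with hs | hs
  · exact improvable_of_exchange b hb hx hs.ne hjj'.symm hj hj'pos hs hi (hxi ▸ hc)
      (onWall_update hc)
  have hpos : ∀ m, 0 ≤ b.coord m x := by
    intro m
    by_cases hm : m = s
    · rwa [hm]
    · rw [hcoord m hm]
      exact hnn m hm
  -- Otherwise `x`, a point of the simplex on a wall, would force `b s` onto that wall.
  have hs0 : b.coord s x = 0 := by
    refine le_antisymm (not_lt.1 fun h => ?_) hs
    have := eq_of_coord_pos b hb hpos (i := i) (hxi ▸ hc) h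
    exact hne (hxi.symm.trans this.symm)
  -- If `x` were a corner, `b j` and `b j'` would both equal it.
  obtain ⟨l, hl⟩ : ∃ l, ¬OnWall k (x l) := by
    by_contra! hall
    apply hjj'
    apply b.ind.injective
    ext l
    rw [eq_of_coord_pos b hb hpos (hall l) hj'pos, eq_of_coord_pos b hb hpos (hall l) hj]
  have hli : l ≠ i := by
    rintro rfl
    exact hl (hxi ▸ hc)
  have hxl : x l = b s l := by rw [hxdef, update_of_ne hli]
  -- A second slide, along axis `l`, leaves the simplex through the facet opposite `b s`: coordinate
  -- `s` becomes negative and those at `j`, `j'` do not decrease.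
  obtain h | ⟨c', hc', -, hnn', hneg', -⟩ := improvable_or_exists_wall b hb (hxl ▸ hl)
  · exact h
  have hz : ∀ m, b.coord m (update x l c') = b.coord m x + (c' - b s l) * slope b l m := by
    intro m
    rw [coord_update, hxl]
  have hzs : b.coord s (update x l c') < 0 := by
    rw [hz, hs0, zero_add]
    exact hneg'
  refine improvable_of_exchange b hb (update_mem_grid hx l hc') hzs.ne hjj'.symm ?_ ?_ hzs hi ?_ ?_
  · rw [hz]
    exact add_pos_of_pos_of_nonneg hj (hnn' j hjs)
  · rw [hz]
    exact add_pos_of_pos_of_nonneg hj'pos (hnn' j' hjs')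
  · rwa [update_of_ne hli.symm, hxi]
  · exact fun m hm => onWall_update hc' m (onWall_update hc m hm)

/-! ### Simplices whose vertices are vertices of the hypercube -/

/-- The vertices of the hypercube. -/
def corners (d k : ℕ) : Set (Fin d → ℝ) := {x | ∀ i, OnWall k (x i)}

theorem corners_subset_grid : corners d k ⊆ grid d k := by
  intro x hx i
  -- A wall value is integral and within bounds; this is read off from the one-dimensional grid.
  have h := update_mem_grid (d := 1) (k := k) (x := 0)
    (fun _ => ⟨⟨0, by simp⟩, by simp, by simp⟩) 0 (hx i) 0
  rwa [update_self] at h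

theorem exists_linked_corners (hd : 2 ≤ d) (hk : 0 < k)
    (b : AffineBasis (Fin (d + 1)) ℝ (Fin d → ℝ)) (hb : range b ⊆ grid d k) :
    ∃ b' : AffineBasis (Fin (d + 1)) ℝ (Fin d → ℝ), range b' ⊆ corners d k ∧
      Linked d k (convexHull ℝ (range b)) (convexHull ℝ (range b')) := by
  induction hn : interiorCount k b using Nat.strong_induction_on generalizing b with
  | _ n ih =>
    by_cases h : ∃ s i, ¬OnWall k (b s i)
    · obtain ⟨s, i, hi⟩ := h
      obtain ⟨b', hgrid, hlink, hlt⟩ := improvable_of_not_onWall hd hk b hb hi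
      obtain ⟨b'', hc, hlink'⟩ := ih _ (hn ▸ hlt) b' hgrid rfl
      exact ⟨b'', hc, hlink.trans hlink'⟩
    · push Not at h
      refine ⟨b, ?_, (isNode_range b hb).linked_refl⟩
      rintro _ ⟨s, rfl⟩
      exact h s

theorem inConvexPosition_corners (hk : 0 < k) : InConvexPosition (corners d k) := by
  intro x hx
  have hk' : (0 : ℝ) < k := by positivity
  -- The coefficients are `±k`, with signs such that `x` is the unique maximizer of `g` among the
  -- corners.
  set g : (Fin d → ℝ) →ₗ[ℝ] ℝ :=
    ∑ i, (2 * x i - k) • (LinearMap.proj i : (Fin d → ℝ) →ₗ[ℝ] ℝ) with hg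
  have hga : ∀ y, g y = ∑ i, (2 * x i - k) * y i := fun y => by simp [hg]
  have hlt : ∀ y ∈ corners d k \ {x}, g y < g x := by
    rintro y ⟨hy, hyx⟩
    rw [hga, hga]
    obtain ⟨i, hi⟩ : ∃ i, y i ≠ x i := by
      by_contra! h
      exact hyx (funext h)
    have key : ∀ l, y l ≠ x l → (2 * x l - k) * y l < (2 * x l - k) * x l := by
      intro l hl
      rcases hx l with h | h <;> rcases hy l with h' | h' <;> rw [h, h'] at hl ⊢
      · exact absurd rfl hl
      · nlinarith
      · nlinarith
      · exact absurd rfl hl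
    refine Finset.sum_lt_sum (fun l _ => ?_) ⟨i, Finset.mem_univ i, key i hi⟩
    by_cases h : y l = x l
    · rw [h]
    · exact (key l h).le
  intro hmem
  have hconv : Convex ℝ {y | g y < g x} := convex_halfSpace_lt g.isLinear _
  have h : x ∈ {y | g y < g x} := convexHull_min hlt hconv hmem
  simp at h

theorem linked_of_corners (hk : 0 < k) (b c : AffineBasis (Fin (d + 1)) ℝ (Fin d → ℝ))
    (hb : range b ⊆ corners d k) (hc : range c ⊆ corners d k) :
    Linked d k (convexHull ℝ (range b)) (convexHull ℝ (range c)) := by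
  induction hn : (range c \ range b).ncard using Nat.strong_induction_on generalizing b with
  | _ n ih =>
    by_cases hsub : range c ⊆ range b
    · have : range c = range b := by
        refine eq_of_subset_of_ncard_le hsub ?_ (finite_range b)
        rw [ncard_range_basis, ncard_range_basis]
      rw [this]
      exact (isNode_range b (hb.trans corners_subset_grid)).linked_refl
    obtain ⟨_, ⟨m, rfl⟩, hm⟩ := not_subset.1 hsub
    -- Otherwise `c m` would be an affine combination of other vertices of `c`. Choosing `b s`
    -- outside `range c` ensures that the exchange loses no common vertex.
    obtain ⟨s, hs, hsc⟩ : ∃ s, b.coord s (c m) ≠ 0 ∧ b s ∉ range c := by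
      by_contra! hall
      have hle : b '' {s | b.coord s (c m) ≠ 0} ⊆ c '' {y | y ≠ m} := by
        rintro _ ⟨s, hs, rfl⟩
        obtain ⟨y, hy⟩ := hall s hs
        refine ⟨y, ?_, hy⟩
        rintro rfl
        exact hm ⟨s, hy.symm⟩
      have hmem : c m ∈ affineSpan ℝ (b '' {s | b.coord s (c m) ≠ 0}) := by
        classical
        have h1 := b.affineCombination_coord_eq_self (c m)
        have h2 : Finset.univ.affineCombination ℝ b (fun i => b.coord i (c m)) ∈
            affineSpan ℝ (b '' {s | b.coord s (c m) ≠ 0}) := by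
          rw [← Finset.affineCombination_filter_of_ne (pred := fun s => b.coord s (c m) ≠ 0)
            _ _ _ (fun _ _ h => h)]
          refine affineCombination_mem_affineSpan_image ?_ ?_ _
          · rw [Finset.sum_filter_ne_zero]
            exact b.sum_coord_apply_eq_one _
          · intro i hi hi'
            exact absurd (Finset.mem_filter.1 hi).2 hi'
        rwa [h1] at h2
      exact c.ind.notMem_affineSpan_sdiff m univ (by
        refine affineSpan_mono ℝ ?_ hmem
        refine hle.trans (image_mono ?_)
        intro y hy
        exact ⟨mem_univ y, hy⟩)
    have hcm := hc (mem_range_self m)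
    obtain ⟨b', hb', -, hlink⟩ := exists_exchange_of_inConvexPosition b
      (hb.trans corners_subset_grid) (corners_subset_grid hcm) hm
      ((inConvexPosition_corners hk).mono (insert_subset hcm hb)) hs
    have hsub' : range b' ⊆ corners d k := by
      rintro _ ⟨j, rfl⟩
      rw [hb']
      by_cases hj : j = s
      · rw [hj, update_self]
        exact hcm
      · rw [update_of_ne hj]
        exact hb (mem_range_self j)
    refine hlink.trans (ih _ ?_ b' hsub' rfl)
    rw [← hn]
    refine ncard_lt_ncard ⟨?_, fun h => ?_⟩ (finite_range c).sdiff
    · rintro y ⟨hy, hyb⟩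
      refine ⟨hy, ?_⟩
      rintro ⟨j, rfl⟩
      have hj : j ≠ s := by
        rintro rfl
        exact hsc hy
      exact hyb ⟨j, by rw [hb', update_of_ne hj]⟩
    · exact (h ⟨mem_range_self m, hm⟩).2 ⟨s, by rw [hb', update_self]⟩

/-- Connectedness includes nonemptiness. The corners `0` and `k` times the canonical basis vectors
already span the space. -/
theorem exists_isNode (hk : 0 < k) : ∃ P, IsNode d k P := by
  have hk' : (k : ℝ) ≠ 0 := by positivity
  have hspan : affineSpan ℝ (corners d k) = ⊤ := by
    have h0 : (0 : Fin d → ℝ) ∈ corners d k := fun i => .inl rfl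
    have hs : ∀ i, Pi.single i (k : ℝ) ∈ corners d k := by
      intro i l
      by_cases h : l = i
      · subst h
        exact .inr (by simp)
      · exact .inl (by simp [h])
    rw [← AffineSubspace.direction_eq_top_iff_of_nonempty ⟨0, subset_affineSpan ℝ _ h0⟩,
      eq_top_iff, ← (Pi.basisFun ℝ (Fin d)).span_eq, Submodule.span_le]
    rintro _ ⟨i, rfl⟩
    have h := vsub_mem_vectorSpan ℝ (hs i) h0
    rw [direction_affineSpan]
    convert! Submodule.smul_mem _ (k : ℝ)⁻¹ h using 1
    ext l
    by_cases hl : l = i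
    · subst hl
      simp [hk']
    · simp [hl]
  obtain ⟨s, hs, b, hb⟩ := AffineBasis.exists_affine_subbasis hspan
  have hfin : Finite s := b.finite
  have := Fintype.ofFinite s
  obtain ⟨c, hc⟩ := exists_basis_of_spanning (W := s)
    (by rw [← Nat.card_coe_set_eq, Nat.card_eq_fintype_card, b.card_eq_finrank_add_one]; simp)
    (by have := b.tot; rwa [hb, Subtype.range_coe] at this)
  exact ⟨_, isNode_range c (hc ▸ hs.trans corners_subset_grid)⟩

end ElementaryMoves

theorem theorem2 (d k : ℕ) (hd : 2 ≤ d) (hk : 0 < k) :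
    ((ElementaryMoves.latticeMoveGraph d k).induce
      {P | ElementaryMoves.IsSimplex P.1.1 ∨
        (ElementaryMoves.vertexSet P.1.1).ncard = d + 2}).Connected := by
  open ElementaryMoves in
  obtain ⟨P, hP⟩ := exists_isNode (d := d) hk
  have hlink : ∀ P Q, IsNode d k P → IsNode d k Q → Linked d k P Q := by
    intro P Q hP hQ
    obtain ⟨b, hb, hPb⟩ := hP.exists_linked_basis
    obtain ⟨c, hc, hQc⟩ := hQ.exists_linked_basis
    obtain ⟨b', hb', hbb⟩ := exists_linked_corners hd hk b hb
    obtain ⟨c', hc', hcc⟩ := exists_linked_corners hd hk c hc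
    exact ((hPb.trans hbb).trans (linked_of_corners hk b' c' hb' hc')).trans
      (hQc.trans hcc).symm
  refine (SimpleGraph.connected_iff _).2 ⟨?_, ⟨⟨⟨⟨P, hP.1⟩, hP.2.1⟩, hP.2.2⟩⟩⟩
  rintro ⟨⟨⟨P, hP⟩, hP'⟩, hP''⟩ ⟨⟨⟨Q, hQ⟩, hQ'⟩, hQ''⟩
  obtain ⟨_, _, h⟩ := hlink P Q ⟨hP, hP', hP''⟩ ⟨hQ, hQ', hQ''⟩
  exact h
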